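/- Let $R,S,T$ be commutative Noetherian local rings with maximal ideals $\mathfrak m_R,\mathfrak m_S,\mathfrak m_T$, and let $\pi_R\colon R\to T$ and $\pi_S\colon S\to T$ be surjective ring homomorphisms. (In particular $R$, $S$, $T$ have a common residue field.) Let $$R\times_T S=\{(r,s)\in R\times S \mid \pi_R(r)=\pi_S(s)\}$$ be the fiber product ring. It is a local ring; let $\mathfrak m=\{(r,s)\in R\times_TS\mid r\in\mathfrak m_R,\ s\in\mathfrak m_S\}$ be its maximal ideal, and let $\mathfrak mR$, $\mathfrak mS$, $\mathfrak mT$ be the extensions of $\mathfrak m$ to $R$, $S$, $T$ along the natural homomorphisms $(r,s)\mapsto r$, $(r,s)\mapsto s$, $(r,s)\mapsto \pi_R(r)=\pi_S(s)$. For an ideal $\mathfrak a$ of a ring $A$, $\operatorname{grade}(\mathfrak a,A)$ denotes the supremum of the lengths of the $A$-regular sequences contained in $\mathfrak a$, and for a local ring $A$, $\operatorname{depth}(A)=\operatorname{grade}(\mathfrak m_A,A)$. Then: (i) If $n\ge 0$ is an integer with $\operatorname{grade}(\mathfrak mT,T)=n$, $\operatorname{grade}(\mathfrak mR,R)>n$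 and $\operatorname{grade}(\mathfrak mS,S)>n$, then $\operatorname{depth}(R\times_TS)=n+1$. (ii) If $\operatorname{depth}(T)=0$, $\operatorname{grade}(\mathfrak mR,R)>0$ and $\operatorname{grade}(\mathfrak mS,S)>0$, then $\operatorname{depth}(R\times_TS)=1$. (iii) If $\operatorname{grade}(\mathfrak mT,T)>0$ and $\operatorname{depth}(R)=0$ or $\operatorname{depth}(S)=0$, then $\operatorname{depth}(R\times_TS)=0$. -/

import Mathlib

/-- `grade(a, M)`: the length of the longest `M`-regular sequence contained in the ideal `a`
(as a supremum in `ℕ∞`; it is attained when `M ≠ 0` is finitely generated over a Noetherian local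
ring and `a` is a proper ideal, the only case used here). -/
noncomputable def idealGrade {A : Type*} [CommRing A] (a : Ideal A)
    (M : Type*) [AddCommGroup M] [Module A M] : ℕ∞ :=
  ⨆ rs : {rs : List A // RingTheory.Sequence.IsRegular M rs ∧ ∀ r ∈ rs, r ∈ a},
    (rs.1.length : ℕ∞)

/-- The depth of a local ring `A`: the grade of its maximal ideal on `A`. -/
noncomputable def localDepth (A : Type*) [CommRing A] [IsLocalRing A] : ℕ∞ :=
  idealGrade (IsLocalRing.maximalIdeal A) A

/-- The fiber product `R ×_T S` (Mathlib's `RingHom.pullback`, the subring of pairs `(r, s)` with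
`πR r = πS s`) of local rings over a local ring `T` is local when `πS` is surjective. -/
theorem isLocalRing_fiberProduct {R S T : Type*} [CommRing R] [CommRing S] [CommRing T]
    [IsLocalRing R] [IsLocalRing S] [IsLocalRing T] (πR : R →+* T) (πS : S →+* T)
    (hS : Function.Surjective πS) : IsLocalRing (πR.pullback πS) :=
  have : IsLocalHom πS := hS.isLocalHom
  RingHom.isLocalRing_pullback πR πS

/-- The ideal `𝔪 = 𝔪_R ×_{𝔪_T} 𝔪_S` of `R ×_T S`: the pairs in `R ×_T S` whose two entries lie in
the maximal ideals of `R` and `S`. -/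
noncomputable def fiberMaximalIdeal {R S T : Type*} [CommRing R] [CommRing S] [CommRing T]
    [IsLocalRing R] [IsLocalRing S] (πR : R →+* T) (πS : S →+* T) : Ideal (πR.pullback πS) :=
  (IsLocalRing.maximalIdeal R).comap (πR.pullbackFst πS) ⊓
    (IsLocalRing.maximalIdeal S).comap (πR.pullbackSnd πS)

/-- `fiberMaximalIdeal` is the maximal ideal of the local ring `R ×_T S`. -/
theorem fiberMaximalIdeal_eq {R S T : Type*} [CommRing R] [CommRing S] [CommRing T]
    [IsLocalRing R] [IsLocalRing S] [IsLocalRing T] (πR : R →+* T) (πS : S →+* T)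
    (hR : Function.Surjective πR) (hS : Function.Surjective πS)
    [IsLocalRing (πR.pullback πS)] :
    fiberMaximalIdeal πR πS = IsLocalRing.maximalIdeal (πR.pullback πS) := by
  have : IsLocalHom πS := hS.isLocalHom
  have : IsLocalHom πR := hR.isLocalHom
  ext x
  have h1 := isUnit_map_iff (πR.pullbackFst πS) x
  have h2 := isUnit_map_iff (πR.pullbackSnd πS) x
  simp only [fiberMaximalIdeal, Ideal.mem_inf, Ideal.mem_comap, IsLocalRing.mem_maximalIdeal,
    mem_nonunits_iff]
  exact ⟨fun h h' => h.1 (h1.2 h'), fun h => ⟨fun h' => h (h1.1 h'), fun h' => h (h2.1 h')⟩⟩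

open CategoryTheory Abelian RingTheory.Sequence IsLocalRing

/-! With P = R ×_T S, the map (r, s) ↦ πR r − πS s gives an exact sequence 0 → P → R × S → T → 0 of
P-modules. As P surjects onto R, S and T, the grades of the extended ideals are the depths of these
P-modules (`idealGrade_map_of_surjective`). Rees' criterion turns depth into vanishing of Ext from
the residue field, and the long exact sequence shows that a kernel has depth n + 1 when the quotient
has depth n and the middle term more (`idealGrade_left_eq_succ`). This is (i), and (ii) is its case
n = 0. For (iii), a socle element r of R maps to an element of T killed by 𝔪T, hence to 0, so (r, 0)
is a socle element of P. -/

theorem natCast_le_idealGrade_iff_exists {A : Type*} [CommRing A] (a : Ideal A)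
    (M : Type*) [AddCommGroup M] [Module A M] (n : ℕ) (hn : n ≠ 0) :
    (n : ℕ∞) ≤ idealGrade a M ↔
      ∃ rs : List A, n ≤ rs.length ∧ (∀ r ∈ rs, r ∈ a) ∧ IsRegular M rs := by
  refine ⟨fun h => ?_, fun ⟨rs, hl, hmem, hreg⟩ => ?_⟩
  -- On the zero module not even the empty sequence is regular, so n = 0 must be excluded.
  · obtain ⟨k, rfl⟩ := Nat.exists_eq_succ_of_ne_zero hn
    have hlt : (k : ℕ∞) < idealGrade a M := lt_of_lt_of_le (by exact_mod_cast k.lt_succ_self) h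
    obtain ⟨⟨rs, hreg, hmem⟩, hrs⟩ := lt_iSup_iff.mp hlt
    exact ⟨rs, by exact_mod_cast hrs, hmem, hreg⟩
  · exact (by exact_mod_cast hl : (n : ℕ∞) ≤ (rs.length : ℕ∞)).trans
      (le_iSup (fun rs : {rs : List A // IsRegular M rs ∧ ∀ r ∈ rs, r ∈ a} =>
        (rs.1.length : ℕ∞)) ⟨rs, hreg, hmem⟩)

/-- Grades do not change under restriction of scalars along a surjective ring homomorphism. -/
theorem idealGrade_map_of_surjective {A B M N : Type*} [CommRing A] [CommRing B]
    [AddCommGroup M] [AddCommGroup N] [Module B M] [Module A N] {φ : A →+* B}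
    (hφ : Function.Surjective φ) (a : Ideal A) (e : M ≃+ N)
    (he : ∀ (r : A) (x : M), e (φ r • x) = r • e x) :
    idealGrade (a.map φ) M = idealGrade a N := by
  have key (rs : List A) : IsRegular M (rs.map φ) ↔ IsRegular N rs :=
    e.isRegular_congr <| List.forall₂_map_left_iff.mpr <|
      List.forall₂_same.mpr fun r _ x => he r x
  have lift (rs : List B) (h : ∀ r ∈ rs, r ∈ a.map φ) :
      ∃ rs' : List A, rs'.map φ = rs ∧ ∀ r ∈ rs', r ∈ a := by
    induction rs with
    | nil => exact ⟨[], by simp⟩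
    | cons b bs ih =>
      obtain ⟨rs', h1, h2⟩ := ih fun r hr => h r (List.mem_cons_of_mem _ hr)
      obtain ⟨x, hx, rfl⟩ := (Ideal.mem_map_iff_of_surjective φ hφ).mp (h b List.mem_cons_self)
      exact ⟨x :: rs', by simp [h1], by simpa [hx] using h2⟩
  apply le_antisymm
  · refine iSup_le ?_
    rintro ⟨rs, hreg, hmem⟩
    obtain ⟨rs', rfl, hmem'⟩ := lift rs hmem
    exact le_iSup_of_le ⟨rs', (key rs').mp hreg, hmem'⟩ (by simp)
  · refine iSup_le ?_
    rintro ⟨rs, hreg, hmem⟩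
    refine le_iSup_of_le ⟨rs.map φ, (key rs).mpr hreg, ?_⟩ (by simp)
    simpa using fun r hr => Ideal.mem_map_of_mem φ (hmem r hr)

theorem eq_zero_of_idealGrade_pos {A M : Type*} [CommRing A] [AddCommGroup M] [Module A M]
    {a : Ideal A} (h : 0 < idealGrade a M) {x : M} (hx : ∀ r ∈ a, r • x = 0) : x = 0 := by
  obtain ⟨rs, hl, hmem, hreg⟩ := (natCast_le_idealGrade_iff_exists a M 1 one_ne_zero).mp
    (by simpa using Order.one_le_iff_pos.mpr h)
  match rs, hl with
  | r :: rs, _ =>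
    exact ((isRegular_cons_iff M r rs).mp hreg).1.right_eq_zero_of_smul
      (hx r (hmem r List.mem_cons_self))

/-- Without a socle element Hom(k, A) = 0, which over a Noetherian ring yields an A-regular element
of Ann k = 𝔪. -/
theorem exists_ne_zero_of_localDepth_eq_zero {A : Type*} [CommRing A] [IsLocalRing A]
    [IsNoetherianRing A] (h : localDepth A = 0) :
    ∃ x : A, x ≠ 0 ∧ ∀ r ∈ maximalIdeal A, r * x = 0 := by
  by_contra! hc
  have : Subsingleton (ResidueField A →ₗ[A] A) := by
    refine subsingleton_of_forall_eq 0 fun f => ?_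
    have h1 : f 1 = 0 := by
      by_contra h1
      obtain ⟨r, hr, hr'⟩ := hc (f 1) h1
      refine hr' ?_
      rw [← smul_eq_mul, ← map_smul, Algebra.smul_def, mul_one,
        ResidueField.algebraMap_eq, (residue_eq_zero_iff r).mpr hr, map_zero]
    ext y
    obtain ⟨y, rfl⟩ := residue_surjective y
    rw [← ResidueField.algebraMap_eq, Algebra.algebraMap_eq_smul_one, map_smul, h1]
    simp
  obtain ⟨r, hr, hreg⟩ := IsSMulRegular.subsingleton_linearMap_iff.mp this
  have hr' : r ∈ maximalIdeal A := by
    have := Module.mem_annihilator.mp hr (1 : ResidueField A)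
    rwa [Algebra.smul_def, mul_one, ResidueField.algebraMap_eq, residue_eq_zero_iff] at this
  have : ((1 : ℕ) : ℕ∞) ≤ localDepth A :=
    (natCast_le_idealGrade_iff_exists _ _ 1 one_ne_zero).mpr ⟨[r], by simp, by simpa using hr',
      IsRegular.of_isWeaklyRegular_of_mem_maximalIdeal A (by simpa using hr')
        ((isWeaklyRegular_singleton_iff A r).mpr hreg)⟩
  simp [h] at this

-- Depth in short exact sequences, via Ext

universe u w

theorem shortExact_shortComplexOfCompEqZero {A : Type u} {L M N : Type w} [CommRing A]
    [AddCommGroup L] [Module A L] [AddCommGroup M] [Module A M] [AddCommGroup N] [Module A N]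
    {f : L →ₗ[A] M} {g : M →ₗ[A] N}
    (hf : Function.Injective f) (hfg : Function.Exact f g) (hg : Function.Surjective g) :
    (ModuleCat.shortComplexOfCompEqZero f g hfg.linearMap_comp_eq_zero).ShortExact where
  exact := ModuleCat.shortComplex_exact _ hfg
  mono_f := (ModuleCat.mono_iff_injective _).mpr hf
  epi_g := (ModuleCat.epi_iff_surjective _).mpr hg

section Ext

variable {A : Type u} [CommRing A] [Small.{w} A]

/-- Rees' characterization of the depth of a module over a local ring. -/
theorem natCast_le_idealGrade_iff_subsingleton_ext [IsLocalRing A] [IsNoetherianRing A]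
    (M : Type w) [AddCommGroup M] [Module A M] [Module.Finite A M] [Nontrivial M] (n : ℕ) :
    (n : ℕ∞) ≤ idealGrade (maximalIdeal A) M ↔
      ∀ i < n, Subsingleton (Ext (ModuleCat.of A (Shrink.{w} (A ⧸ maximalIdeal A)))
        (ModuleCat.of A M) i) := by
  -- Nakayama's lemma.
  have hlt : maximalIdeal A • (⊤ : Submodule A (ModuleCat.of A M)) < ⊤ :=
    (Submodule.top_ne_ideal_smul_of_le_jacobson_annihilator (M := M)
      (maximalIdeal_le_jacobson _)).symm.lt_top
  have tfae (k : ℕ) := (ModuleCat.exists_isRegular_tfae (maximalIdeal A) k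
    (ModuleCat.of A M) hlt).out 1 3
  rcases eq_or_ne n 0 with rfl | hn
  · simp
  rw [natCast_le_idealGrade_iff_exists _ _ _ hn]
  constructor
  · rintro ⟨rs, hl, hmem, hreg⟩ i hi
    exact (tfae rs.length).mpr ⟨rs, rfl, hmem, hreg⟩ i (hi.trans_le hl)
  · intro h
    obtain ⟨rs, hl, hmem, hreg⟩ := (tfae n).mp h
    exact ⟨rs, hl.ge, hmem, hreg⟩

variable [IsLocalRing A] [IsNoetherianRing A] {L M N : Type w}
  [AddCommGroup L] [Module A L] [Module.Finite A L] [Nontrivial L]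
  [AddCommGroup M] [Module A M] [Module.Finite A M] [Nontrivial M]
  [AddCommGroup N] [Module A N] [Module.Finite A N] [Nontrivial N]
  {f : L →ₗ[A] M} {g : M →ₗ[A] N}

theorem natCast_le_idealGrade_middle (hf : Function.Injective f)
    (hfg : Function.Exact f g) (hg : Function.Surjective g) {n : ℕ}
    (hL : (n : ℕ∞) ≤ idealGrade (maximalIdeal A) L)
    (hN : (n : ℕ∞) ≤ idealGrade (maximalIdeal A) N) :
    (n : ℕ∞) ≤ idealGrade (maximalIdeal A) M := by
  rw [natCast_le_idealGrade_iff_subsingleton_ext] at *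
  refine fun i hi => subsingleton_of_forall_eq 0 fun x => ?_
  have := hN i hi
  obtain ⟨y, rfl⟩ := Ext.covariant_sequence_exact₂ _
    (shortExact_shortComplexOfCompEqZero hf hfg hg) x (this.elim _ _)
  rw [(hL i hi).elim y 0, Ext.zero_comp]

/-- Extⁱ(k, N) sits between Extⁱ(k, M) and Extⁱ⁺¹(k, L), hence the n + 1 for L. -/
theorem natCast_le_idealGrade_right (hf : Function.Injective f)
    (hfg : Function.Exact f g) (hg : Function.Surjective g) {n : ℕ}
    (hL : ((n + 1 : ℕ) : ℕ∞) ≤ idealGrade (maximalIdeal A) L)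
    (hM : (n : ℕ∞) ≤ idealGrade (maximalIdeal A) M) :
    (n : ℕ∞) ≤ idealGrade (maximalIdeal A) N := by
  rw [natCast_le_idealGrade_iff_subsingleton_ext] at *
  refine fun i hi => subsingleton_of_forall_eq 0 fun x => ?_
  obtain ⟨y, rfl⟩ := Ext.covariant_sequence_exact₃ _
    (shortExact_shortComplexOfCompEqZero hf hfg hg) x rfl ((hL (i + 1) (by omega)).elim _ _)
  rw [(hM i hi).elim y 0, Ext.zero_comp]

theorem natCast_succ_le_idealGrade_left (hf : Function.Injective f)
    (hfg : Function.Exact f g) (hg : Function.Surjective g) {n : ℕ}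
    (hM : ((n + 1 : ℕ) : ℕ∞) ≤ idealGrade (maximalIdeal A) M)
    (hN : (n : ℕ∞) ≤ idealGrade (maximalIdeal A) N) :
    ((n + 1 : ℕ) : ℕ∞) ≤ idealGrade (maximalIdeal A) L := by
  rw [natCast_le_idealGrade_iff_subsingleton_ext] at *
  have hS := shortExact_shortComplexOfCompEqZero hf hfg hg
  intro i hi
  match i with
  -- No connecting map arrives in degree 0; there Hom(k, L) embeds in Hom(k, M).
  | 0 =>
    have := hS.mono_f
    have := hM 0 hi
    exact (Ext.postcomp_mk₀_injective_of_mono _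
      (ModuleCat.shortComplexOfCompEqZero f g hfg.linearMap_comp_eq_zero).f).subsingleton
  | i + 1 =>
    refine subsingleton_of_forall_eq 0 fun x => ?_
    obtain ⟨y, rfl⟩ := Ext.covariant_sequence_exact₁ _ hS x ((hM (i + 1) hi).elim _ _) rfl
    rw [(hN i (by omega)).elim y 0, Ext.zero_comp]

/-- The depth of a kernel, when the quotient has smaller depth than the middle term. -/
theorem idealGrade_left_eq_succ (hf : Function.Injective f)
    (hfg : Function.Exact f g) (hg : Function.Surjective g) {n : ℕ}
    (hM : (n : ℕ∞) < idealGrade (maximalIdeal A) M)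
    (hN : idealGrade (maximalIdeal A) N = n) :
    idealGrade (maximalIdeal A) L = n + 1 := by
  have hM' : ((n + 1 : ℕ) : ℕ∞) ≤ idealGrade (maximalIdeal A) M := by
    simpa using Order.add_one_le_of_lt hM
  refine le_antisymm (le_of_not_gt fun h => ?_) ?_
  · have h2 : ((n + 1 + 1 : ℕ) : ℕ∞) ≤ idealGrade (maximalIdeal A) L := by
      simpa using Order.add_one_le_of_lt h
    have := natCast_le_idealGrade_right hf hfg hg h2 hM'
    rw [hN, Nat.cast_le] at this
    omega
  · simpa using natCast_succ_le_idealGrade_left hf hfg hg hM' hN.ge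

end Ext

/-! ### Fiber products and their exact sequence -/

section FiberProduct

universe u₀ u₁ u₂ u₃

variable {P : Type u₀} {R : Type u₁} {S : Type u₂} {T : Type u₃}
  [CommRing P] [CommRing R] [CommRing S] [CommRing T]

theorem isNoetherian_of_surjective_algebraMap [Algebra P R] [IsNoetherianRing R]
    (h : Function.Surjective (algebraMap P R)) : IsNoetherian P R :=
  have : RingHomSurjective (algebraMap P R) := ⟨h⟩
  let l : R →ₛₗ[algebraMap P R] R :=
    { toFun := id
      map_add' := fun _ _ => rfl
      map_smul' := fun r x => Algebra.smul_def r x }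
  (l.isNoetherian_iff_of_bijective Function.bijective_id).mpr inferInstance

/-- The fiber product of Noetherian rings along surjections is Noetherian. -/
theorem isNoetherianRing_fiberProduct [IsNoetherianRing R] [IsNoetherianRing S]
    (πR : R →+* T) (πS : S →+* T)
    (hR : Function.Surjective πR) (hS : Function.Surjective πS) :
    IsNoetherianRing (πR.pullback πS) := by
  let : Algebra (πR.pullback πS) R := (πR.pullbackFst πS).toAlgebra
  let : Algebra (πR.pullback πS) S := (πR.pullbackSnd πS).toAlgebra
  have : IsNoetherian (πR.pullback πS) R :=
    isNoetherian_of_surjective_algebraMap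
      (RingHom.surjective_pullbackFst_of_surjective πR πS hS)
  have : IsNoetherian (πR.pullback πS) S :=
    isNoetherian_of_surjective_algebraMap
      (RingHom.surjective_pullbackSnd_of_surjective πR πS hR)
  exact isNoetherian_of_injective
    ((Algebra.linearMap (πR.pullback πS) R).prod (Algebra.linearMap (πR.pullback πS) S))
    fun x y h => Subtype.ext h

/-- The depth of a Noetherian local ring `P` that is the pullback of surjections `R → T ← S`. -/
theorem localDepth_eq_succ_of_pullback [IsLocalRing P] [IsNoetherianRing P]
    [Nontrivial R] [Nontrivial S] [Nontrivial T]
    {p : P →+* R} {q : P →+* S} {πR : R →+* T} {πS : S →+* T}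
    (hp : Function.Surjective p) (hq : Function.Surjective q) (hR : Function.Surjective πR)
    (hcomm : ∀ x, πR (p x) = πS (q x)) (hinj : ∀ x, p x = 0 → q x = 0 → x = 0)
    (hex : ∀ r s, πR r = πS s → ∃ x, p x = r ∧ q x = s) {n : ℕ}
    (hT : idealGrade ((maximalIdeal P).map (πR.comp p)) T = n)
    (hnR : (n : ℕ∞) < idealGrade ((maximalIdeal P).map p) R)
    (hnS : (n : ℕ∞) < idealGrade ((maximalIdeal P).map q) S) :
    localDepth P = n + 1 := by
  let : Module P R := Module.compHom R p
  let : Module P S := Module.compHom S q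
  let : Module P T := Module.compHom T (πR.comp p)
  let p' : P →ₗ[P] R := { p with map_smul' := p.map_mul }
  let q' : P →ₗ[P] S := { q with map_smul' := q.map_mul }
  let πR' : R →ₗ[P] T := { πR with map_smul' := fun x r => πR.map_mul (p x) r }
  let πS' : S →ₗ[P] T :=
    { πS with map_smul' := fun x s => (πS.map_mul (q x) s).trans (by rw [← hcomm]; rfl) }
  have : Module.Finite P R := .of_surjective p' hp
  have : Module.Finite P S := .of_surjective q' hq
  have : Module.Finite P T := .of_surjective (πR' ∘ₗ p') (hR.comp hp)
  -- The Ext lemmas need all modules in one universe.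
  let eP := ULift.moduleEquiv.{u₀, u₀, max u₁ u₂ u₃} (R := P) (M := P)
  let eR := ULift.moduleEquiv.{u₀, u₁, max u₀ u₂ u₃} (R := P) (M := R)
  let eS := ULift.moduleEquiv.{u₀, u₂, max u₀ u₁ u₃} (R := P) (M := S)
  let eT := ULift.moduleEquiv.{u₀, u₃, max u₀ u₁ u₂} (R := P) (M := T)
  have hRp : Function.Surjective (πR.comp p) := hR.comp hp
  rw [idealGrade_map_of_surjective hRp _ eT.symm.toAddEquiv fun _ _ => rfl] at hT
  rw [idealGrade_map_of_surjective hp _ eR.symm.toAddEquiv fun _ _ => rfl] at hnR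
  rw [idealGrade_map_of_surjective hq _ eS.symm.toAddEquiv fun _ _ => rfl] at hnS
  have hP : localDepth P = idealGrade (maximalIdeal P) (ULift.{max u₁ u₂ u₃} P) := by
    have := idealGrade_map_of_surjective (φ := RingHom.id P) Function.surjective_id
      (maximalIdeal P) eP.symm.toAddEquiv fun _ _ => rfl
    rwa [Ideal.map_id] at this
  have : Small.{max u₀ u₁ u₂ u₃} P := small_lift.{u₀, max u₀ u₁ u₂ u₃} P
  -- The split sequence R → R × S → S bounds the depth of the product.
  have hM : (n : ℕ∞) < idealGrade (maximalIdeal P)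
      (ULift.{max u₀ u₂ u₃} R × ULift.{max u₀ u₁ u₃} S) := by
    refine lt_of_lt_of_le (by exact_mod_cast n.lt_succ_self) <|
      natCast_le_idealGrade_middle (n := n + 1) (f := LinearMap.inl P _ _)
        (g := LinearMap.snd P _ _) LinearMap.inl_injective .inl_snd LinearMap.snd_surjective ?_ ?_
    · simpa using Order.add_one_le_of_lt hnR
    · simpa using Order.add_one_le_of_lt hnS
  rw [hP]
  refine idealGrade_left_eq_succ
    (f := ((eR.symm.toLinearMap ∘ₗ p').prod (eS.symm.toLinearMap ∘ₗ q')) ∘ₗ eP.toLinearMap)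
    (g := eT.symm.toLinearMap ∘ₗ
      (πR' ∘ₗ eR.toLinearMap ∘ₗ LinearMap.fst P _ _ - πS' ∘ₗ eS.toLinearMap ∘ₗ LinearMap.snd P _ _))
    ?_ ?_ ?_ hM hT
  · refine (injective_iff_map_eq_zero _).mpr fun x hx => ULift.ext _ _ (hinj x.down ?_ ?_)
    · exact congrArg (fun y => y.1.down) hx
    · exact congrArg (fun y => y.2.down) hx
  · rintro ⟨⟨r⟩, ⟨s⟩⟩
    have h0 : (eT.symm.toLinearMap ∘ₗ (πR' ∘ₗ eR.toLinearMap ∘ₗ LinearMap.fst P _ _ -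
        πS' ∘ₗ eS.toLinearMap ∘ₗ LinearMap.snd P _ _)) (⟨r⟩, ⟨s⟩) = ⟨πR r - πS s⟩ := rfl
    rw [h0]
    constructor
    · intro h
      obtain ⟨x, rfl, rfl⟩ := hex r s (sub_eq_zero.mp (congrArg ULift.down h))
      exact ⟨⟨x⟩, rfl⟩
    · rintro ⟨x, hx⟩
      have h1 : p x.down = r := congrArg (fun y => y.1.down) hx
      have h2 : q x.down = s := congrArg (fun y => y.2.down) hx
      rw [← h1, ← h2, hcomm, sub_self]
      rfl
  · rintro ⟨t⟩
    obtain ⟨r, rfl⟩ := hR t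
    exact ⟨(⟨r⟩, 0), ULift.ext _ _ ((congrArg (πR r - ·) πS.map_zero).trans (sub_zero _))⟩

/-- A socle element of `R` is the first entry of a socle element of the fiber product, when `T`
has positive depth. -/
theorem localDepth_eq_zero_of_pullback [IsLocalRing P] [IsLocalRing R] [IsNoetherianRing R]
    {p : P →+* R} {q : P →+* S} {πR : R →+* T} {πS : S →+* T}
    (hp : Function.Surjective p) (hR : Function.Surjective πR)
    (hex : ∀ r s, πR r = πS s → ∃ x, p x = r ∧ q x = s)
    (hinj : ∀ x, p x = 0 → q x = 0 → x = 0)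
    (hT : 0 < idealGrade ((maximalIdeal P).map (πR.comp p)) T) (h0 : localDepth R = 0) :
    localDepth P = 0 := by
  obtain ⟨r, hr, hmr⟩ := exists_ne_zero_of_localDepth_eq_zero h0
  have hloc : IsLocalHom p := hp.isLocalHom
  have hpm (x : P) (hx : x ∈ maximalIdeal P) : p x * r = 0 :=
    hmr _ (map_nonunit p x hx)
  have hRp : Function.Surjective (πR.comp p) := hR.comp hp
  have hπ : πR r = 0 := by
    refine eq_zero_of_idealGrade_pos hT fun t ht => ?_
    obtain ⟨x, hx, rfl⟩ := (Ideal.mem_map_iff_of_surjective _ hRp).mp ht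
    rw [smul_eq_mul, RingHom.comp_apply, ← map_mul, hpm x hx, map_zero]
  -- y = (r, 0) is killed by the maximal ideal of P, so positive depth would force r = 0.
  obtain ⟨y, rfl, hy⟩ := hex r 0 (by rw [hπ, map_zero])
  by_contra hne
  refine hr ?_
  rw [eq_zero_of_idealGrade_pos (pos_iff_ne_zero.mpr hne) (x := y) fun x hx => hinj _ ?_ ?_,
    map_zero]
  · rw [smul_eq_mul, map_mul, hpm x hx]
  · rw [smul_eq_mul, map_mul, hy, mul_zero]

end FiberProduct

theorem theorem4p2 {R S T : Type*} [CommRing R] [CommRing S] [CommRing T]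
    [IsLocalRing R] [IsLocalRing S] [IsLocalRing T]
    [IsNoetherianRing R] [IsNoetherianRing S] [IsNoetherianRing T]
    (πR : R →+* T) (πS : S →+* T)
    (hR : Function.Surjective πR) (hS : Function.Surjective πS) :
    letI : IsLocalRing (πR.pullback πS) := isLocalRing_fiberProduct πR πS hS
    (∀ n : ℕ,
      idealGrade ((fiberMaximalIdeal πR πS).map (πR.comp (πR.pullbackFst πS))) T = n →
      (n : ℕ∞) < idealGrade ((fiberMaximalIdeal πR πS).map (πR.pullbackFst πS)) R →
      (n : ℕ∞) < idealGrade ((fiberMaximalIdeal πR πS).map (πR.pullbackSnd πS)) S →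
      localDepth (πR.pullback πS) = n + 1) ∧
    (localDepth T = 0 →
      0 < idealGrade ((fiberMaximalIdeal πR πS).map (πR.pullbackFst πS)) R →
      0 < idealGrade ((fiberMaximalIdeal πR πS).map (πR.pullbackSnd πS)) S →
      localDepth (πR.pullback πS) = 1) ∧
    (0 < idealGrade ((fiberMaximalIdeal πR πS).map (πR.comp (πR.pullbackFst πS))) T →
      (localDepth R = 0 ∨ localDepth S = 0) →
      localDepth (πR.pullback πS) = 0) := by
  have : IsLocalRing (πR.pullback πS) := isLocalRing_fiberProduct πR πS hS
  have := isNoetherianRing_fiberProduct πR πS hR hS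
  rw [fiberMaximalIdeal_eq πR πS hR hS]
  have hp := RingHom.surjective_pullbackFst_of_surjective πR πS hS
  have hq := RingHom.surjective_pullbackSnd_of_surjective πR πS hR
  have hcomm (x : πR.pullback πS) : πR (πR.pullbackFst πS x) = πS (πR.pullbackSnd πS x) := x.2
  have hinj (x : πR.pullback πS) (h1 : πR.pullbackFst πS x = 0) (h2 : πR.pullbackSnd πS x = 0) :
      x = 0 := Subtype.ext (Prod.ext h1 h2)
  have hex (r : R) (s : S) (h : πR r = πS s) :
      ∃ x, πR.pullbackFst πS x = r ∧ πR.pullbackSnd πS x = s := ⟨⟨(r, s), h⟩, rfl, rfl⟩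
  have main (n : ℕ) := localDepth_eq_succ_of_pullback hp hq hR hcomm hinj hex (n := n)
  refine ⟨main, fun hT h1 h2 => ?_, fun hT h => ?_⟩
  -- Grade is monotone in the ideal, so depth T = 0 gives grade(𝔪T, T) = 0.
  · have hle : (maximalIdeal (πR.pullback πS)).map (πR.comp (πR.pullbackFst πS)) ≤
        maximalIdeal T := by
      have : IsLocalHom (πR.comp (πR.pullbackFst πS)) := (hR.comp hp).isLocalHom
      exact ((local_hom_TFAE _).out 0 2).mp this
    have hT' : idealGrade ((maximalIdeal (πR.pullback πS)).map
        (πR.comp (πR.pullbackFst πS))) T = 0 := by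
      refine le_antisymm (hT ▸ iSup_le fun ⟨rs, hreg, hmem⟩ => ?_) zero_le
      exact le_iSup_of_le ⟨rs, hreg, fun r hr => hle (hmem r hr)⟩ le_rfl
    simpa using main 0 (by simpa using hT') (by simpa using h1) (by simpa using h2)
  · rcases h with h | h
    · exact localDepth_eq_zero_of_pullback hp hR hex hinj hT h
    · rw [show πR.comp (πR.pullbackFst πS) = πS.comp (πR.pullbackSnd πS) from
        RingHom.ext hcomm] at hT
      exact localDepth_eq_zero_of_pullback (q := πR.pullbackFst πS) (πS := πR) hq hS
        (fun s r h => (hex r s h.symm).imp fun _ hx => hx.symm) (fun x h1 h2 => hinj x h2 h1) hT h
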